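/- Let $p$ be a prime and let $n,k$ be integers with $k\ge 1$ and $n\ge pk$. Let $KG^p\binom{[n]}{k}$ be the usual Kneser hypergraph: the $p$-uniform hypergraph whose vertices are the $k$-subsets of $[n]=\{1,\dots,n\}$ and whose edges are the sets of $p$ pairwise disjoint vertices. Let $KG^p\binom{[n]}{k}^{\sim}_{2\text{-stab}}$ be the almost $2$-stable Kneser hypergraph: the $p$-uniform hypergraph whose vertices are the $k$-subsets $S$ of $[n]$ with $|i-j|\ge 2$ for all distinct $i,j\in S$ (so $S$ contains no two consecutive integers, while $1$ and $n$ do not count as consecutive), and whose edges are the sets of $p$ pairwise disjoint vertices. The chromatic number $\chi(\mathcal H)$ of a hypergraph is the least number $t$ of colors such that its vertices can be colored with $t$ colors with no edge monochromatic. Then $$\chi\left(KG^p\binom{[n]}{k}^{\sim}_{2\text{-stab}}\right)\ \ge\ \left\lceil\frac{n-(k-1)p}{p-1}\right\rceil,$$ and in fact equality holds, and this is also the chromatic number of the usual Kneser hypergraph: $$\chi\left(KG^p\binom{[n]}{k}^{\sim}_{2\text{-stab}}\right)=\left\lceil\frac{n-(k-1)p}{p-1}\right\rceil=\chi\left(KG^p\binom{[n]}{k}\right).$$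 -/

import Mathlib

namespace Hypergraph

/-- A hypergraph `H` is properly colorable with `t` colors: there is a map from its vertex set to a
set of `t` colors such that every edge contains two vertices of different colors. -/
def ProperlyColorable {α : Type*} (H : Hypergraph α) (t : ℕ) : Prop :=
  ∃ c : H.vertexSet → Fin t, ∀ e ∈ H.edgeSet,
    ∃ x y : H.vertexSet, (x : α) ∈ e ∧ (y : α) ∈ e ∧ c x ≠ c y

/-- The chromatic number of a hypergraph: the smallest `t` such that `H` is properly colorable
with `t` colors (and `⊤` if there is no such `t`). -/
noncomputable def chromaticNumber {α : Type*} (H : Hypergraph α) : ℕ∞ :=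
  ⨅ t ∈ {t : ℕ | H.ProperlyColorable t}, (t : ℕ∞)

/-- The `r`-uniform hypergraph on a family `F` of finite sets whose edges are the
`r`-element subfamilies of `F` consisting of pairwise disjoint sets. -/
def disjointness (r : ℕ) (F : Set (Finset ℕ)) : Hypergraph (Finset ℕ) where
  vertexSet := F
  edgeSet := {e | e ⊆ F ∧ e.encard = r ∧ e.Pairwise Disjoint}
  subset_vertexSet_of_mem_edgeSet' := fun _ he => he.1

/-- The `k`-element subsets of `{1, …, n}`. -/
def kSubsets (n k : ℕ) : Set (Finset ℕ) :=
  {S | S ⊆ Finset.Icc 1 n ∧ S.card = k}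

/-- The `k`-element subsets of `{1, …, n}` any two distinct elements of which differ by at
least `s` (in linear, not cyclic, order). -/
def almostStableSubsets (n k s : ℕ) : Set (Finset ℕ) :=
  {S | S ∈ kSubsets n k ∧ ∀ i ∈ S, ∀ j ∈ S, i ≠ j → (s : ℤ) ≤ |(i : ℤ) - (j : ℤ)|}

/-- The Kneser hypergraph: vertices are the `k`-subsets of `{1, …, n}`, edges are the
`r`-tuples of pairwise disjoint vertices. -/
def kneser (r n k : ℕ) : Hypergraph (Finset ℕ) :=
  disjointness r (kSubsets n k)

/-- The almost `s`-stable Kneser hypergraph. -/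
def almostStableKneser (r n k s : ℕ) : Hypergraph (Finset ℕ) :=
  disjointness r (almostStableSubsets n k s)

end Hypergraph

/-! The upper bound is greedy: color a set by the block of `p - 1` consecutive integers containing
its minimum, and give the last color to everything that remains. Since the stable vertices form a
subfamily, the same coloring serves both hypergraphs, and the lower bound for the stable one carries
over to the usual one.

The lower bound is topological. Suppose a proper `t`-coloring exists with `n > p * (k - 1) + t * (p
- 1)`. Order the nonzero sign vectors on `n` coordinates, with signs in `ZMod p`, by inclusion. Send
`x` to its alternation length and first sign while that length is at most `p * (k - 1)`. A longer
alternating subsequence contains, by pigeonhole, `k` entries of one sign, and alternation keeps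
their positions nonadjacent: a stable vertex. From then on, record for each color the set of signs
whose level set in `x` contains a vertex of that color. Properness makes these sets proper subsets
of `ZMod p`, so their total size is at most `t * (p - 1)` and serves as a level; an average of one
of them serves as a sign. The result is a monotone equivariant map to fewer than `n` levels of `ZMod
p`.

Such a map is excluded by a Dold-type theorem, `not_exists_equivariant`. Chains `c i` on the source
satisfy `∂ c (i + 1) = D i (c i)` and cochains `γ i` on the target satisfy `D i (γ (i + 1)) = δ (γ
i)`, where `D i` is alternately `σ - 1` and the norm. Their pairing, summed over the group, stays
equal to `1` modulo `p` in every degree, yet vanishes in a degree where the target has too few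
levels. -/

namespace Hypergraph

/-! ### Cochains on lists -/

section Cochains

variable {E Q R : Type*} [CommRing R]

/-- The simplicial coboundary, as a function on lists of vertices. -/
def coboundaryFun : (List E → R) → List E → R
  | _, [] => 0
  | u, x :: l => u l - coboundaryFun (fun m => u (x :: m)) l

lemma coboundaryFun_add (u v : List E → R) :
    coboundaryFun (u + v) = coboundaryFun u + coboundaryFun v := by
  funext l
  induction l generalizing u v with
  | nil => simp [coboundaryFun]
  | cons x l ih =>
    have h := ih (fun m => u (x :: m)) (fun m => v (x :: m))
    simp only [Pi.add_apply] at h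
    change u l + v l - coboundaryFun ((fun m => u (x :: m)) + fun m => v (x :: m)) l = _
    rw [h]
    simp only [coboundaryFun, Pi.add_apply]
    ring

/-- The simplicial coboundary on functions of lists of vertices. -/
def coboundary : (List E → R) →+ (List E → R) :=
  AddMonoidHom.mk' coboundaryFun coboundaryFun_add

@[simp] lemma coboundary_nil (u : List E → R) : coboundary u [] = 0 := rfl

lemma coboundary_cons (u : List E → R) (x : E) (l : List E) :
    coboundary u (x :: l) = u l - coboundary (fun m => u (x :: m)) l := rfl

/-- The dual of the prism operator between the identity and a map `s`. -/
def prismFun (s : E → E) : (List E → R) → List E → R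
  | _, [] => 0
  | u, x :: l => u (x :: s x :: l.map s) - prismFun s (fun m => u (x :: m)) l

lemma prismFun_add (s : E → E) (u v : List E → R) :
    prismFun s (u + v) = prismFun s u + prismFun s v := by
  funext l
  induction l generalizing u v with
  | nil => simp [prismFun]
  | cons x l ih =>
    have h := ih (fun m => u (x :: m)) (fun m => v (x :: m))
    simp only [Pi.add_apply] at h
    change u _ + v _ - prismFun s ((fun m => u (x :: m)) + fun m => v (x :: m)) l = _
    rw [h]
    simp only [prismFun, Pi.add_apply]
    ring

/-- The dual of the prism operator between the identity and a map `s`. -/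
def prism (s : E → E) : (List E → R) →+ (List E → R) :=
  AddMonoidHom.mk' (prismFun s) (prismFun_add s)

lemma prism_nil (s : E → E) (u : List E → R) : prism s u [] = 0 := rfl

lemma prism_cons (s : E → E) (u : List E → R) (x : E) (l : List E) :
    prism s u (x :: l) = u (x :: s x :: l.map s) - prism s (fun m => u (x :: m)) l := rfl

/-- Pullback of cochains along a map of vertices. -/
def pullback (f : E → Q) : (List Q → R) →+ (List E → R) where
  toFun u l := u (l.map f)
  map_zero' := rfl
  map_add' _ _ := rfl

lemma pullback_apply (f : E → Q) (u : List Q → R) (l : List E) :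
    pullback f u l = u (l.map f) := rfl

lemma coboundary_pullback (f : E → Q) (u : List Q → R) :
    coboundary (pullback f u) = pullback f (coboundary u) := by
  funext l
  induction l generalizing u with
  | nil => rfl
  | cons x l ih => exact congrArg (u (l.map f) - ·) (ih (fun m => u (f x :: m)))

lemma coboundary_coboundary (u : List E → R) : coboundary (coboundary u) = 0 := by
  funext l
  induction l generalizing u with
  | nil => rfl
  | cons x l ih =>
    have h : (fun m => coboundary u (x :: m)) = u - coboundary (fun m => u (x :: m)) := rfl
    rw [coboundary_cons, h, map_sub, Pi.sub_apply, ih]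
    simp

lemma prism_coboundary_add (s : E → E) (u : List E → R) :
    prism s (coboundary u) + coboundary (prism s u) = pullback s u - u := by
  funext l
  induction l generalizing u with
  | nil => simp [prism_nil, pullback_apply]
  | cons x l ih =>
    have h1 : (fun m => coboundary u (x :: m)) = u - coboundary (fun m => u (x :: m)) := rfl
    have h2 : (fun m => prism s u (x :: m)) =
        pullback s (fun m => u (x :: s x :: m)) - prism s (fun m => u (x :: m)) := rfl
    have h3 := ih (fun m => u (x :: m))
    simp only [Pi.add_apply, Pi.sub_apply, pullback_apply] at h3 ⊢
    rw [prism_cons, coboundary_cons (prism s u), h1, h2, map_sub, map_sub, coboundary_pullback,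
      coboundary_cons, coboundary_cons]
    simp only [Pi.sub_apply, pullback_apply, List.map_cons]
    linear_combination h3

/-- The dual of the cone with apex `a` over the image of `s`. -/
def cone (a : E) (s : E → E) : (List E → R) →+ (List E → R) where
  toFun u l := u (a :: l.map s)
  map_zero' := rfl
  map_add' _ _ := rfl

lemma cone_coboundary_add (a : E) (s : E → E) (u : List E → R) :
    cone a s (coboundary u) + coboundary (cone a s u) = pullback s u := by
  have h : cone a s u = pullback s (fun m => u (a :: m)) := rfl
  rw [h, coboundary_pullback]
  funext l
  change u (l.map s) - coboundary (fun m => u (a :: m)) (l.map s) + _ = _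
  simp [pullback_apply]

/-- The contracting homotopy moving `x` through `s x` to `a`. -/
def homotopy (a : E) (s : E → E) : (List E → R) →+ (List E → R) := cone a s - prism s

/-- The cone links the pullback along `s` to zero and the prism links it to the identity; in the
difference the pullback cancels. -/
lemma homotopy_coboundary (a : E) (s : E → E) (u : List E → R) :
    homotopy a s (coboundary u) = u - coboundary (homotopy a s u) := by
  have h1 := cone_coboundary_add a s u
  have h2 := prism_coboundary_add s u
  simp only [homotopy, AddMonoidHom.sub_apply, map_sub]
  linear_combination h1 - h2

/-- The `i`-th differential of the minimal resolution of a cyclic group of order `p`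
generated by `σ`. -/
def periodicDiff (p : ℕ) (σ : E → E) (i : ℕ) : (List E → R) →+ (List E → R) :=
  if Even i then pullback σ - AddMonoidHom.id _ else ∑ j ∈ Finset.range p, pullback σ^[j]

lemma periodicDiff_even {p : ℕ} {σ : E → E} {i : ℕ} (hi : Even i) (u : List E → R) :
    periodicDiff p σ i u = pullback σ u - u := by
  simp [periodicDiff, hi]

lemma periodicDiff_odd {p : ℕ} {σ : E → E} {i : ℕ} (hi : ¬ Even i) (u : List E → R) :
    periodicDiff p σ i u = ∑ j ∈ Finset.range p, pullback σ^[j] u := by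
  simp [periodicDiff, hi]

lemma periodicDiff_add_two {p : ℕ} {σ : E → E} (i : ℕ) :
    (periodicDiff p σ (i + 2) : (List E → R) →+ _) = periodicDiff p σ i := by
  simp [periodicDiff, Nat.even_add]

lemma coboundary_periodicDiff {p : ℕ} {σ : E → E} (i : ℕ) (u : List E → R) :
    coboundary (periodicDiff p σ i u) = periodicDiff p σ i (coboundary u) := by
  by_cases hi : Even i
  · simp [periodicDiff_even hi, coboundary_pullback]
  · simp [periodicDiff_odd hi, coboundary_pullback]

lemma pullback_pullback {S : Type*} (f : E → Q) (g : Q → S) (u : List S → R) :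
    pullback f (pullback g u) = pullback (g ∘ f) u := by
  funext l
  simp [pullback_apply]

lemma pullback_id (u : List E → R) : pullback id u = u := by
  funext l
  simp [pullback_apply]

lemma periodicDiff_periodicDiff {p : ℕ} {σ : E → E} (hσ : σ^[p] = id) (i : ℕ)
    (u : List E → R) : periodicDiff p σ i (periodicDiff p σ (i + 1) u) = 0 := by
  have key := Finset.sum_range_sub (fun j => pullback σ^[j] u) p
  rw [hσ, pullback_id, Function.iterate_zero, pullback_id, sub_self, Finset.sum_sub_distrib] at key
  by_cases hi : Even i
  · rw [periodicDiff_even hi, periodicDiff_odd (by simpa [Nat.even_add_one] using hi), map_sum,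
      ← key]
    simp [pullback_pullback]
  · rw [periodicDiff_odd hi, periodicDiff_even (by simpa [Nat.even_add_one] using hi), ← key]
    simp [pullback_pullback, ← Function.iterate_succ']

end Cochains

/-! ### Chains in a tower of equivariant posets, each of which contracts in the next one -/

/-- An increasing sequence of subposets `A i` invariant under `σ`, such that `A i` contracts in
`A (i + 1)` along `x ≤ s i x ≥ a (i + 1)`. -/
structure IsContractingTower {E : Type*} [Preorder E] (σ : E → E) (a : ℕ → E) (s : ℕ → E → E)
    (A : ℕ → E → Prop) : Prop where
  mono : Monotone σ
  mem_map : ∀ i x, A i x → A i (σ x)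
  mem_base : ∀ i, A i (a i)
  mem_succ : ∀ i x, A i x → A (i + 1) x
  mem_push : ∀ i x, A i x → A (i + 1) (s i x)
  push_mono : ∀ i, Monotone (s i)
  le_push : ∀ i x, x ≤ s i x
  base_le : ∀ i x, a (i + 1) ≤ s i x

section Tower

variable {E R : Type*} [CommRing R]

/-- Chains `c i`, as functionals on cochains, whose boundaries are
`∂ c (i + 1) = periodicDiff i (c i)`. -/
def towerChain (p : ℕ) (σ : E → E) (a : ℕ → E) (s : ℕ → E → E) : ℕ → (List E → R) →+ R
  | 0 => Pi.evalAddMonoidHom _ [a 0]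
  | i + 1 => (towerChain p σ a s i).comp
      ((periodicDiff p σ i).comp (homotopy (a (i + 1)) (s i)))

lemma towerChain_succ_apply (p : ℕ) (σ : E → E) (a : ℕ → E) (s : ℕ → E → E) (i : ℕ)
    (u : List E → R) : towerChain p σ a s (i + 1) u =
      towerChain p σ a s i (periodicDiff p σ i (homotopy (a (i + 1)) (s i) u)) := rfl

/-- The homotopy identity leaves the error term `D i (δ v)`. The chain kills it because `δ` commutes
with `D i` and consecutive differentials compose to zero; in degree zero, because `δ v` takes the
value `v []` at every vertex. -/
lemma towerChain_coboundary {p : ℕ} {σ : E → E} (hσ : σ^[p] = id) (a : ℕ → E) (s : ℕ → E → E)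
    (i : ℕ) (u : List E → R) :
    towerChain p σ a s (i + 1) (coboundary u) = towerChain p σ a s i (periodicDiff p σ i u) := by
  have key : ∀ v : List E → R, towerChain p σ a s i (periodicDiff p σ i (coboundary v)) = 0 := by
    induction i generalizing u with
    | zero =>
      intro v
      rw [periodicDiff_even (by simp)]
      simp [towerChain, pullback_apply, coboundary_cons]
    | succ i ih =>
      intro v
      rw [← coboundary_periodicDiff, towerChain_succ_apply, homotopy_coboundary, map_sub,
        map_sub, periodicDiff_periodicDiff hσ, ih u, map_zero, sub_zero]
  rw [towerChain_succ_apply, homotopy_coboundary, map_sub, map_sub, key, sub_zero]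

/-- The simplices of dimension `i` in the `i`-th level of a tower. -/
def IsLevelSimplex [Preorder E] (A : ℕ → E → Prop) (i : ℕ) (l : List E) : Prop :=
  l.Pairwise (· ≤ ·) ∧ (∀ x ∈ l, A i x) ∧ l.length = i + 1

/-- The prism consists of the simplices `x₀ ≤ … ≤ xⱼ ≤ s xⱼ ≤ … ≤ s xₙ`. The clause on lower bounds
in `hu` lets the induction put the head back in front of a simplex without breaking the order. -/
lemma prism_eq_zero [Preorder E] {A B : E → Prop} {s : E → E} (hs : Monotone s)
    (hle : ∀ x, x ≤ s x) (hAB : ∀ x, A x → B x) (hAs : ∀ x, A x → B (s x)) (l : List E)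
    (hl : l.Pairwise (· ≤ ·)) (hA : ∀ x ∈ l, A x) (u : List E → R)
    (hu : ∀ m : List E, m.Pairwise (· ≤ ·) → (∀ x ∈ m, B x) → m.length = l.length + 1 →
      (∀ y, (∀ x ∈ l, y ≤ x) → ∀ x ∈ m, y ≤ x) → u m = 0) :
    prism s u l = 0 := by
  induction l generalizing u with
  | nil => rfl
  | cons x l ih =>
    rw [List.pairwise_cons] at hl
    rw [List.forall_mem_cons] at hA
    have h1 : u (x :: s x :: l.map s) = 0 := by
      apply hu
      · simp only [List.pairwise_cons, List.mem_cons, List.mem_map, List.pairwise_map]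
        refine ⟨?_, ?_, hl.2.imp fun h => hs h⟩
        · rintro y (rfl | ⟨z, hz, rfl⟩)
          · exact hle x
          · exact (hl.1 z hz).trans (hle z)
        · rintro y ⟨z, hz, rfl⟩
          exact hs (hl.1 z hz)
      · simp only [List.mem_cons, List.mem_map]
        rintro y (rfl | rfl | ⟨z, hz, rfl⟩)
        · exact hAB _ hA.1
        · exact hAs _ hA.1
        · exact hAs _ (hA.2 z hz)
      · simp
      · intro y hy z hz
        simp only [List.mem_cons, List.mem_map] at hy hz
        rcases hz with rfl | rfl | ⟨w, hw, rfl⟩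
        · exact hy z (Or.inl rfl)
        · exact (hy x (Or.inl rfl)).trans (hle x)
        · exact (hy w (Or.inr hw)).trans (hle w)
    rw [prism_cons, h1, ih hl.2 hA.2, sub_zero]
    intro m hm hB hlen hlow
    apply hu
    · exact List.pairwise_cons.2 ⟨hlow x hl.1, hm⟩
    · exact List.forall_mem_cons.2 ⟨hAB _ hA.1, hB⟩
    · simp [hlen]
    · intro y hy z hz
      rw [List.forall_mem_cons] at hy
      rcases List.mem_cons.1 hz with rfl | hz
      · exact hy.1
      · exact hlow y hy.2 z hz

lemma IsLevelSimplex.map_iterate [Preorder E] {σ : E → E} {a : ℕ → E} {s : ℕ → E → E}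
    {A : ℕ → E → Prop} (hT : IsContractingTower σ a s A) {i : ℕ} {l : List E}
    (hl : IsLevelSimplex A i l) (j : ℕ) : IsLevelSimplex A i (l.map σ^[j]) := by
  induction j with
  | zero => simpa using hl
  | succ j ih =>
    rw [Function.iterate_succ', ← List.map_map]
    obtain ⟨h1, h2, h3⟩ := ih
    refine ⟨List.pairwise_map.2 (h1.imp fun h => hT.mono h), ?_, by simpa using h3⟩
    intro x hx
    obtain ⟨y, hy, rfl⟩ := List.mem_map.1 hx
    exact hT.mem_map i y (h2 y hy)

lemma towerChain_eq_zero [Preorder E] {σ : E → E} {a : ℕ → E} {s : ℕ → E → E}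
    {A : ℕ → E → Prop} (hT : IsContractingTower σ a s A) (p i : ℕ) (u : List E → R)
    (hu : ∀ l, IsLevelSimplex A i l → u l = 0) : towerChain p σ a s i u = 0 := by
  induction i generalizing u with
  | zero => exact hu [a 0] ⟨by simp, by simpa using hT.mem_base 0, rfl⟩
  | succ i ih =>
    rw [towerChain_succ_apply]
    apply ih
    have hK : ∀ l, IsLevelSimplex A i l → homotopy (a (i + 1)) (s i) u l = 0 := by
      rintro l ⟨h1, h2, h3⟩
      change u (a (i + 1) :: l.map (s i)) - prism (s i) u l = 0
      rw [hu, prism_eq_zero (hT.push_mono i) (hT.le_push i) (hT.mem_succ i) (hT.mem_push i) l h1 h2,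
        sub_zero]
      · intro m hm hB hlen _
        exact hu m ⟨hm, hB, by rw [hlen, h3]⟩
      · refine ⟨?_, ?_, by simp [h3]⟩
        · simp only [List.pairwise_cons, List.mem_map, List.pairwise_map]
          refine ⟨?_, h1.imp fun h => hT.push_mono i h⟩
          rintro y ⟨z, _, rfl⟩
          exact hT.base_le i z
        · simp only [List.mem_cons, List.mem_map]
          rintro y (rfl | ⟨z, hz, rfl⟩)
          · exact hT.mem_base _
          · exact hT.mem_push i z (h2 z hz)
    intro l hl
    by_cases hi : Even i
    · have := hK _ (hl.map_iterate hT 1)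
      rw [periodicDiff_even hi, Pi.sub_apply, pullback_apply, hK l hl, sub_zero]
      simpa using this
    · rw [periodicDiff_odd hi, Finset.sum_apply]
      exact Finset.sum_eq_zero fun j _ => hK _ (hl.map_iterate hT j)

lemma towerChain_congr [Preorder E] {σ : E → E} {a : ℕ → E} {s : ℕ → E → E}
    {A : ℕ → E → Prop} (hT : IsContractingTower σ a s A) (p i : ℕ) {u v : List E → R}
    (huv : ∀ l, IsLevelSimplex A i l → u l = v l) :
    towerChain p σ a s i u = towerChain p σ a s i v := by
  rw [← sub_eq_zero, ← map_sub]
  exact towerChain_eq_zero hT p i _ fun l hl => by rw [Pi.sub_apply, huv l hl, sub_self]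

end Tower

/-! ### Normalized cochains on the levelled poset `ℕ × ZMod p` -/

section Levelled

variable {p : ℕ}

/-- The generator of the cyclic action on `ℕ × ZMod p`. -/
def rotate (q : ℕ × ZMod p) : ℕ × ZMod p := (q.1, q.2 + 1)

lemma rotate_injective : Function.Injective (rotate : ℕ × ZMod p → _) := by
  rintro ⟨a, b⟩ ⟨c, d⟩ h
  simpa [rotate] using h

lemma rotate_iterate (j : ℕ) (q : ℕ × ZMod p) : rotate^[j] q = (q.1, q.2 + j) := by
  induction j with
  | zero => simp
  | succ j ih => rw [Function.iterate_succ_apply', ih]; simp [rotate, add_assoc]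

lemma rotate_iterate_self : (rotate : ℕ × ZMod p → _)^[p] = id := by
  funext q
  simp [rotate_iterate]

/-- A section of `periodicDiff i` on its image, using that the action is free. -/
def periodicSection (p i : ℕ) (u : List (ℕ × ZMod p) → ZMod p) :
    List (ℕ × ZMod p) → ZMod p
  | [] => 0
  | q :: l => if Even i then
      ∑ j ∈ Finset.range q.2.val, u ((q :: l).map rotate^[j + (p - q.2.val)])
    else if q.2 = 0 then u (q :: l) else 0

/-- Each orbit is based at the translate whose first vertex has sign `0`. A solution for `σ - 1` is
the partial sum of `u` along the orbit from that base, which closes up because the norm of `u`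
vanishes. A solution for the norm is `u` restricted to the base, since `u` is invariant. -/
lemma periodicDiff_periodicSection [NeZero p] (i : ℕ) (u : List (ℕ × ZMod p) → ZMod p)
    (hu : periodicDiff p rotate (i + 1) u = 0) (hnil : u [] = 0) :
    periodicDiff p rotate i (periodicSection p i u) = u := by
  funext l
  by_cases hi : Even i
  · rw [periodicDiff_odd (by simpa [Nat.even_add_one] using hi)] at hu
    rw [periodicDiff_even hi]
    cases l with
    | nil => simp [pullback_apply, periodicSection, hnil]
    | cons q l =>
      have hu' := congrFun hu (q :: l)
      rw [Finset.sum_apply] at hu'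
      have hlt := ZMod.val_lt q.2
      have hstep : ∀ j, ((q :: l).map rotate).map rotate^[j] =
          (q :: l).map (rotate^[j + 1] : ℕ × ZMod p → _) := fun j => by
        rw [List.map_map, Function.iterate_succ]
      have hval : (q.2 + 1).val = if q.2.val + 1 = p then 0 else q.2.val + 1 := by
        have h1 : q.2 + 1 = ((q.2.val + 1 : ℕ) : ZMod p) := by simp
        rw [h1, ZMod.val_natCast]
        split_ifs with h
        · rw [h, Nat.mod_self]
        · exact Nat.mod_eq_of_lt (by omega)
      have e1 : periodicSection p i u ((q :: l).map rotate) =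
          ∑ j ∈ Finset.range (q.2 + 1).val,
            u ((q :: l).map rotate^[j + (p - (q.2 + 1).val) + 1]) := by
        rw [List.map_cons]
        simp only [periodicSection, hi, if_true]
        refine Finset.sum_congr rfl fun j _ => ?_
        rw [← hstep]
        rfl
      have e2 : periodicSection p i u (q :: l) =
          ∑ j ∈ Finset.range q.2.val, u ((q :: l).map rotate^[j + (p - q.2.val)]) := by
        simp only [periodicSection, hi, if_true]
      rw [Pi.sub_apply, pullback_apply, e1, e2, hval]
      split_ifs with h
      · have hr : Finset.range p = Finset.range (q.2.val + 1) := by rw [h]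
        rw [hr, Finset.sum_range_succ'] at hu'
        simp only [pullback_apply, Function.iterate_zero, List.map_id, Pi.zero_apply] at hu'
        have : p - q.2.val = 1 := by omega
        rw [this]
        simp only [Finset.range_zero, Finset.sum_empty]
        linear_combination -hu'
      · have e3 : ∀ j, j + (p - (q.2.val + 1)) + 1 = j + (p - q.2.val) := fun j => by omega
        simp only [e3]
        rw [Finset.sum_range_succ, Nat.add_sub_cancel' hlt.le, rotate_iterate_self, List.map_id]
        ring
  · rw [periodicDiff_even (by simpa [Nat.even_add_one] using hi), sub_eq_zero] at hu
    have hinv : ∀ j, pullback rotate^[j] u = u := by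
      intro j
      induction j with
      | zero => simp [pullback_id]
      | succ j ih => rw [Function.iterate_succ', ← pullback_pullback, hu, ih]
    rw [periodicDiff_odd hi, Finset.sum_apply]
    cases l with
    | nil => simp [pullback_apply, periodicSection, hnil]
    | cons q l =>
      have h : ∀ j, pullback rotate^[j] (periodicSection p i u) (q :: l) =
          if q.2 + (j : ZMod p) = 0 then u (q :: l) else 0 := by
        intro j
        conv_rhs => rw [← hinv j]
        simp [pullback_apply, periodicSection, hi, rotate_iterate]
      simp only [h]
      rw [Finset.sum_eq_single (-q.2).val]
      · simp
      · intro j hj hne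
        rw [if_neg]
        intro h0
        apply hne
        rw [← eq_neg_of_add_eq_zero_right h0, ZMod.val_cast_of_lt (Finset.mem_range.1 hj)]
      · intro hj
        exact absurd (Finset.mem_range.2 (ZMod.val_lt _)) hj

/-- A compatible sequence of equivariant cochains on `ℕ × ZMod p`. -/
def periodicCochain (p : ℕ) : ℕ → List (ℕ × ZMod p) → ZMod p
  | 0 => fun l => match l with
    | [q] => if q.2 = 0 then 1 else 0
    | _ => 0
  | i + 1 => periodicSection p i (coboundary (periodicCochain p i))

lemma sum_periodicCochain_zero [NeZero p] (q : ℕ × ZMod p) :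
    ∑ j ∈ Finset.range p, periodicCochain p 0 [rotate^[j] q] = 1 := by
  simp only [rotate_iterate, periodicCochain]
  rw [Finset.sum_eq_single (-q.2).val]
  · simp
  · intro j hj hne
    rw [if_neg]
    intro h0
    apply hne
    rw [← eq_neg_of_add_eq_zero_right h0, ZMod.val_cast_of_lt (Finset.mem_range.1 hj)]
  · intro hj
    exact absurd (Finset.mem_range.2 (ZMod.val_lt _)) hj

lemma coboundary_singleton_indicator {E R : Type*} [CommRing R] (u : List E → R)
    (h1 : ∀ x, u [x] = 1) (h2 : ∀ l, l.length ≠ 1 → u l = 0) : coboundary u = 0 := by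
  funext l
  match l with
  | [] => rfl
  | [x] => simp [coboundary_cons, h2]
  | x :: y :: l =>
    have h3 : (fun m => u (x :: y :: m)) = 0 := funext fun m => h2 _ (by simp)
    rw [coboundary_cons, coboundary_cons, h3, map_zero]
    cases l with
    | nil => simp [h1]
    | cons z l => simp [h2]

/-- Solvability is inductive: `D (i + 2) = D i` turns the obstruction into `δ (δ _)`. In degree zero
the norm is the constant `1` on vertices, a cocycle. -/
lemma periodicDiff_periodicCochain [NeZero p] (i : ℕ) :
    periodicDiff p rotate i (periodicCochain p (i + 1)) = coboundary (periodicCochain p i) := by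
  apply periodicDiff_periodicSection _ _ _ rfl
  rw [← coboundary_periodicDiff]
  induction i with
  | zero =>
    apply coboundary_singleton_indicator
    · intro q
      rw [periodicDiff_odd (by simp), Finset.sum_apply]
      exact sum_periodicCochain_zero q
    · intro l hl
      rw [periodicDiff_odd (by simp), Finset.sum_apply]
      refine Finset.sum_eq_zero fun j _ => ?_
      rw [pullback_apply]
      match l with
      | [] => rfl
      | [_] => simp at hl
      | _ :: _ :: _ => rfl
  | succ i ih =>
    rw [periodicDiff_add_two, periodicCochain,
      periodicDiff_periodicSection _ _ (by rwa [← coboundary_periodicDiff]) rfl,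
      coboundary_coboundary]

/-- The two faces omitting one of two equal neighbors cancel; every other face is still degenerate.
-/
lemma coboundary_eq_zero_of_not_isChain {E R : Type*} [CommRing R] (l : List E)
    (hl : ¬ l.IsChain (· ≠ ·)) (u : List E → R)
    (hu : ∀ m : List E, ¬ m.IsChain (· ≠ ·) → u m = 0) : coboundary u l = 0 := by
  induction l generalizing u with
  | nil => rfl
  | cons x l ih =>
    cases l with
    | nil => simp at hl
    | cons y l =>
      rw [List.isChain_cons_cons, not_and_or, not_not] at hl
      by_cases hc : (y :: l).IsChain (· ≠ ·)
      · obtain rfl : x = y := hl.resolve_right (not_not_intro hc)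
        have h : (fun m => u (x :: x :: m)) = 0 := funext fun m => hu _ (by simp)
        rw [coboundary_cons, coboundary_cons, h]
        simp
      · rw [coboundary_cons, hu _ hc, ih hc, sub_zero]
        intro m hm
        exact hu _ fun h => hm h.of_cons

lemma periodicCochain_eq_zero (i : ℕ) (l : List (ℕ × ZMod p)) (hl : ¬ l.IsChain (· ≠ ·)) :
    periodicCochain p i l = 0 := by
  induction i generalizing l with
  | zero =>
    match l with
    | [] => rfl
    | [_] => simp at hl
    | _ :: _ :: _ => rfl
  | succ i ih =>
    have h0 : ∀ l : List (ℕ × ZMod p), ¬ l.IsChain (· ≠ ·) →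
        coboundary (periodicCochain p i) l = 0 :=
      fun l hl => coboundary_eq_zero_of_not_isChain l hl _ ih
    have h1 : ∀ j, ¬ (l.map (rotate^[j] : ℕ × ZMod p → _)).IsChain (· ≠ ·) := by
      intro j h
      rw [List.isChain_map] at h
      exact hl (h.imp fun a b hab h => hab (by rw [h]))
    cases l with
    | nil => rfl
    | cons q l =>
      simp only [periodicCochain, periodicSection]
      split_ifs
      · exact Finset.sum_eq_zero fun j _ => h0 _ (h1 _)
      · exact h0 _ hl
      · rfl

end Levelled

/-- The `i`-th level of a contracting tower has no equivariant monotone map to a levelled poset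
with only `i` levels. -/
theorem not_exists_equivariant {E : Type*} [Preorder E] {p : ℕ} [Fact p.Prime] {σ : E → E}
    {a : ℕ → E} {s : ℕ → E → E} {A : ℕ → E → Prop} (hσ : σ^[p] = id)
    (hT : IsContractingTower σ a s A) (i : ℕ) (f : E → ℕ × ZMod p)
    (hf : ∀ x, A i x → f (σ x) = rotate (f x))
    (hmono : ∀ x y, A i x → A i y → x ≤ y → f x = f y ∨ (f x).1 < (f y).1)
    (hrank : ∀ x, A i x → (f x).1 < i) : False := by
  have hmem : ∀ j ≤ i, ∀ x, A j x → A i x := by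
    intro j hj x hx
    exact Nat.le_induction hx (fun n _ h => hT.mem_succ n x h) i hj
  have hiter : ∀ m x, A i x → A i (σ^[m] x) ∧ f (σ^[m] x) = rotate^[m] (f x) := by
    intro m x hx
    induction m with
    | zero => exact ⟨hx, rfl⟩
    | succ m ih =>
      rw [Function.iterate_succ_apply', Function.iterate_succ_apply', hf _ ih.1, ih.2]
      exact ⟨hT.mem_map i _ ih.1, rfl⟩
  have hpull : ∀ j ≤ i, ∀ m (u : List (ℕ × ZMod p) → ZMod p) l, IsLevelSimplex A j l →
      pullback σ^[m] (pullback f u) l = pullback f (pullback rotate^[m] u) l := by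
    intro j hj m u l hl
    simp only [pullback_apply, List.map_map]
    refine congrArg u (List.map_congr_left fun x hx => ?_)
    exact (hiter m x (hmem j hj x (hl.2.1 x hx))).2
  have hdiff : ∀ j ≤ i, ∀ (u : List (ℕ × ZMod p) → ZMod p),
      towerChain p σ a s j (periodicDiff p σ j (pullback f u)) =
        towerChain p σ a s j (pullback f (periodicDiff p rotate j u)) := by
    intro j hj u
    refine towerChain_congr hT p j fun l hl => ?_
    by_cases hev : Even j
    · simpa [periodicDiff_even hev] using hpull j hj 1 u l hl
    · simp only [periodicDiff_odd hev, Finset.sum_apply, map_sum]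
      exact Finset.sum_congr rfl fun m _ => hpull j hj m u l hl
  have hstep : ∀ j < i, ∀ u v : List (ℕ × ZMod p) → ZMod p,
      periodicDiff p rotate j v = coboundary u →
      towerChain p σ a s (j + 1) (pullback f (periodicDiff p rotate j v)) =
        towerChain p σ a s j (pullback f (periodicDiff p rotate j u)) := by
    intro j hj u v huv
    rw [huv, ← coboundary_pullback, towerChain_coboundary hσ, hdiff j hj.le]
  let e : ℕ → ℕ → ZMod p := fun j m =>
    towerChain p σ a s j (pullback f (pullback rotate^[m] (periodicCochain p j)))
  have hsum : ∀ j ≤ i, ∑ m ∈ Finset.range p, e j m = 1 := by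
    intro j hj
    induction j with
    | zero => exact sum_periodicCochain_zero (f (a 0))
    | succ j ih =>
      rw [← ih (by omega)]
      by_cases hev : Even j
      -- Here `D j` is `σ - 1`, so only increments in `m` can be compared: the two pairings differ
      -- by a constant, whose sum over `p` translates is zero in `ZMod p`.
      · have hd : ∀ m, e (j + 1) (m + 1) - e j (m + 1) = e (j + 1) m - e j m := by
          intro m
          have h := hstep j hj (pullback rotate^[m] (periodicCochain p j))
            (pullback rotate^[m] (periodicCochain p (j + 1))) (by
              rw [coboundary_pullback, ← periodicDiff_periodicCochain, periodicDiff_even hev,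
                periodicDiff_even hev, map_sub, pullback_pullback, pullback_pullback,
                ← Function.iterate_succ, ← Function.iterate_succ'])
          simp only [periodicDiff_even hev, map_sub, pullback_pullback rotate,
            ← Function.iterate_succ] at h
          linear_combination h
        have hc : ∀ m, e (j + 1) m - e j m = e (j + 1) 0 - e j 0 := by
          intro m
          induction m with
          | zero => rfl
          | succ m ihm => rw [hd, ihm]
        rw [← sub_eq_zero, ← Finset.sum_sub_distrib, Finset.sum_congr rfl fun m _ => hc m]
        simp
      · have h := hstep j hj _ _ (periodicDiff_periodicCochain j)
        simpa only [periodicDiff_odd hev, map_sum] using h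
  have hzero : ∀ m, e i m = 0 := by
    intro m
    refine towerChain_eq_zero hT p i _ fun l hl => ?_
    rw [pullback_apply, pullback_apply]
    apply periodicCochain_eq_zero
    intro hch
    -- Without equal neighbors, the `i + 1` vertices would have strictly increasing levels, all
    -- below `i`.
    have hlt : (l.map fun x => (f x).1).Pairwise (· < ·) := by
      rw [← List.isChain_iff_pairwise, List.isChain_map, List.isChain_iff_getElem]
      rw [List.isChain_map, List.isChain_map, List.isChain_iff_getElem] at hch
      intro n hn
      refine (hmono _ _ (hl.2.1 _ (List.getElem_mem _)) (hl.2.1 _ (List.getElem_mem _))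
        (List.pairwise_iff_getElem.1 hl.1 n (n + 1) _ hn (Nat.lt_succ_self n))).resolve_left ?_
      exact fun h => hch n hn (congrArg _ h)
    have hcard := List.toFinset_card_of_nodup (hlt.imp fun h => h.ne)
    have hsub : (l.map fun x => (f x).1).toFinset ⊆ Finset.range i := by
      intro y hy
      obtain ⟨x, hx, rfl⟩ := List.mem_map.1 (List.mem_toFinset.1 hy)
      exact Finset.mem_range.2 (hrank x (hl.2.1 x hx))
    have := Finset.card_le_card hsub
    rw [hcard, List.length_map, hl.2.2, Finset.card_range] at this
    omega
  have h1 := hsum i le_rfl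
  simp only [hzero, Finset.sum_const_zero] at h1
  exact zero_ne_one h1

/-! ### Sign vectors -/

section SignVectors

variable {p n : ℕ}

/-- Nonzero vectors in `(ZMod p ∪ {0})^n`, encoded as graphs of partial functions from
`{1, …, n}` to `ZMod p`. -/
def IsSignVector (n : ℕ) (x : Finset (ℕ × ZMod p)) : Prop :=
  x.Nonempty ∧ (∀ q ∈ x, 1 ≤ q.1 ∧ q.1 ≤ n) ∧ ∀ q ∈ x, ∀ r ∈ x, q.1 = r.1 → q = r

/-- The generator of the cyclic action on sign vectors. -/
def rotateVector (x : Finset (ℕ × ZMod p)) : Finset (ℕ × ZMod p) := x.image rotate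

lemma mk_add_one_mem_rotateVector {x : Finset (ℕ × ZMod p)} {i : ℕ} {j : ZMod p} :
    (i, j + 1) ∈ rotateVector x ↔ (i, j) ∈ x :=
  rotate_injective.mem_finset_image (a := (i, j))

lemma rotateVector_iterate_self : (rotateVector : Finset (ℕ × ZMod p) → _)^[p] = id := by
  have h : ∀ j (x : Finset (ℕ × ZMod p)), rotateVector^[j] x = x.image rotate^[j] := by
    intro j x
    induction j with
    | zero => simp
    | succ j ih =>
      rw [Function.iterate_succ_apply', ih, rotateVector, Finset.image_image,
        Function.iterate_succ']
  funext x
  rw [h, rotate_iterate_self, Finset.image_id, id]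

lemma IsSignVector.rotateVector {x : Finset (ℕ × ZMod p)} (hx : IsSignVector n x) :
    IsSignVector n (rotateVector x) := by
  obtain ⟨h1, h2, h3⟩ := hx
  refine ⟨h1.image _, ?_, ?_⟩
  · intro q hq
    obtain ⟨r, hr, rfl⟩ := Finset.mem_image.1 hq
    exact h2 r hr
  · intro q hq r hr h
    obtain ⟨q', hq', rfl⟩ := Finset.mem_image.1 hq
    obtain ⟨r', hr', rfl⟩ := Finset.mem_image.1 hr
    rw [h3 q' hq' r' hr' h]

/-- The fresh coordinate `i + 2` can always be filled with the sign `0`, and the rest then dropped.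
-/
lemma isContractingTower_isSignVector :
    IsContractingTower (rotateVector : Finset (ℕ × ZMod p) → _) (fun i => {(i + 1, 0)})
      (fun i x => insert (i + 2, 0) x) (fun i => IsSignVector (i + 1)) where
  mono _ _ h := Finset.image_subset_image h
  mem_map _ _ h := h.rotateVector
  mem_base i := by simp [IsSignVector]
  mem_succ i x h := ⟨h.1, fun q hq => ⟨(h.2.1 q hq).1, (h.2.1 q hq).2.trans (by omega)⟩, h.2.2⟩
  mem_push i x h := by
    obtain ⟨-, h2, h3⟩ := h
    refine ⟨Finset.insert_nonempty _ _, ?_, ?_⟩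
    · intro q hq
      rcases Finset.mem_insert.1 hq with rfl | hq
      · simp
      · have := h2 q hq
        omega
    · intro q hq r hr hqr
      rcases Finset.mem_insert.1 hq with rfl | hq <;> rcases Finset.mem_insert.1 hr with rfl | hr
      · rfl
      · have := h2 r hr
        simp only at hqr
        omega
      · have := h2 q hq
        simp only at hqr
        omega
      · exact h3 q hq r hr hqr
  push_mono _ _ _ h := Finset.insert_subset_insert _ h
  le_push _ _ := Finset.subset_insert _ _
  base_le _ _ := by simp

/-- The values of `y` at any two consecutive elements of its support differ. -/
def IsAlternating (y : Finset (ℕ × ZMod p)) : Prop :=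
  ∀ q ∈ y, ∀ r ∈ y, q.1 < r.1 → (∀ z ∈ y, z.1 ≤ q.1 ∨ r.1 ≤ z.1) → q.2 ≠ r.2

open Classical in
/-- The length of the longest alternating subsequence of a sign vector. -/
noncomputable def alternation (x : Finset (ℕ × ZMod p)) : ℕ :=
  (x.powerset.filter IsAlternating).sup Finset.card

lemma card_le_alternation {x y : Finset (ℕ × ZMod p)} (hyx : y ⊆ x) (hy : IsAlternating y) :
    y.card ≤ alternation x := by
  classical
  exact Finset.le_sup (f := Finset.card) (by simp [hyx, hy])

lemma exists_card_eq_alternation (x : Finset (ℕ × ZMod p)) :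
    ∃ y ⊆ x, IsAlternating y ∧ y.card = alternation x := by
  classical
  obtain ⟨y, hy, h⟩ := Finset.exists_mem_eq_sup (x.powerset.filter IsAlternating)
    ⟨∅, by simp [IsAlternating]⟩ Finset.card
  rw [Finset.mem_filter, Finset.mem_powerset] at hy
  exact ⟨y, hy.1, hy.2, h.symm⟩

lemma alternation_mono {x x' : Finset (ℕ × ZMod p)} (h : x ⊆ x') :
    alternation x ≤ alternation x' := by
  obtain ⟨y, hy, ha, hc⟩ := exists_card_eq_alternation x
  exact hc ▸ card_le_alternation (hy.trans h) ha

lemma alternation_pos {x : Finset (ℕ × ZMod p)} (h : x.Nonempty) : 0 < alternation x := by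
  obtain ⟨q, hq⟩ := h
  have : ({q} : Finset (ℕ × ZMod p)).card ≤ alternation x :=
    card_le_alternation (by simpa using hq) (by simp [IsAlternating])
  rwa [Finset.card_singleton] at this

lemma IsAlternating.rotateVector {y : Finset (ℕ × ZMod p)} (hy : IsAlternating y) :
    IsAlternating (rotateVector y) := by
  intro q hq r hr hlt hz
  obtain ⟨q', hq', rfl⟩ := Finset.mem_image.1 hq
  obtain ⟨r', hr', rfl⟩ := Finset.mem_image.1 hr
  have := hy q' hq' r' hr' hlt fun z hz' =>
    hz (rotate z) (Finset.mem_image_of_mem (rotate : ℕ × ZMod p → _) hz')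
  simpa [rotate] using this

lemma alternation_le_rotateVector (x : Finset (ℕ × ZMod p)) :
    alternation x ≤ alternation (rotateVector x) := by
  obtain ⟨y, hy, ha, hc⟩ := exists_card_eq_alternation x
  rw [← hc, ← Finset.card_image_of_injective y rotate_injective]
  exact card_le_alternation (Finset.image_subset_image hy) ha.rotateVector

lemma alternation_rotateVector [NeZero p] (x : Finset (ℕ × ZMod p)) :
    alternation (rotateVector x) = alternation x := by
  refine le_antisymm ?_ (alternation_le_rotateVector x)
  have h : ∀ j (y : Finset (ℕ × ZMod p)), alternation y ≤ alternation (rotateVector^[j] y) := by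
    intro j y
    induction j with
    | zero => rfl
    | succ j ih =>
      rw [Function.iterate_succ_apply']
      exact ih.trans (alternation_le_rotateVector _)
  have h1 := h (p - 1) (rotateVector x)
  rwa [← Function.iterate_succ_apply, Nat.succ_eq_add_one,
    Nat.sub_add_cancel (NeZero.one_le : 1 ≤ p), rotateVector_iterate_self] at h1

lemma IsAlternating.insert {y : Finset (ℕ × ZMod p)} (hy : IsAlternating y) {q : ℕ × ZMod p}
    (hlt : ∀ r ∈ y, q.1 < r.1) (hne : ∀ r ∈ y, (∀ z ∈ y, r.1 ≤ z.1) → q.2 ≠ r.2) :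
    IsAlternating (insert q y) := by
  intro a ha b hb hab hz
  rcases Finset.mem_insert.1 ha with rfl | ha' <;> rcases Finset.mem_insert.1 hb with rfl | hb'
  · exact absurd hab (lt_irrefl _)
  · refine hne b hb' fun z hzy => (hz z (Finset.mem_insert_of_mem hzy)).resolve_left ?_
    exact not_le.2 (hlt z hzy)
  · exact absurd hab (hlt a ha').not_gt
  · exact hy a ha' b hb' hab fun z hzy => hz z (Finset.mem_insert_of_mem hzy)

/-- An element of `x` with the smallest coordinate. -/
def IsFirst (x : Finset (ℕ × ZMod p)) (q : ℕ × ZMod p) : Prop :=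
  q ∈ x ∧ ∀ r ∈ x, q.1 ≤ r.1

open Classical in
/-- The first nonzero value of a sign vector. -/
noncomputable def firstSign (x : Finset (ℕ × ZMod p)) : ZMod p :=
  if h : ∃ q, IsFirst x q then h.choose.2 else 0

lemma exists_isFirst {x : Finset (ℕ × ZMod p)} (hx : x.Nonempty) : ∃ q, IsFirst x q :=
  Finset.exists_min_image x Prod.fst hx

lemma IsSignVector.firstSign_eq {x : Finset (ℕ × ZMod p)} (hx : IsSignVector n x)
    {q : ℕ × ZMod p} (hq : IsFirst x q) : firstSign x = q.2 := by
  have h : ∃ q, IsFirst x q := ⟨q, hq⟩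
  rw [firstSign, dif_pos h]
  have hc := h.choose_spec
  rw [hx.2.2 _ hc.1 q hq.1 (le_antisymm (hc.2 q hq.1) (hq.2 _ hc.1))]

lemma IsSignVector.firstSign_rotateVector {x : Finset (ℕ × ZMod p)} (hx : IsSignVector n x) :
    firstSign (Hypergraph.rotateVector x) = firstSign x + 1 := by
  obtain ⟨q, hq⟩ := exists_isFirst hx.1
  rw [hx.firstSign_eq hq, hx.rotateVector.firstSign_eq (q := rotate q)]
  · rfl
  · refine ⟨Finset.mem_image_of_mem _ hq.1, fun r hr => ?_⟩
    obtain ⟨r', hr', rfl⟩ := Finset.mem_image.1 hr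
    exact hq.2 r' hr'

/-- A longest alternating `y` in `x` is also longest in `x'`. In either vector a first sign
different from that of `y` could be prepended to lengthen it. -/
lemma IsSignVector.firstSign_eq_of_subset {x x' : Finset (ℕ × ZMod p)} (hx : IsSignVector n x)
    (hx' : IsSignVector n x') (hsub : x ⊆ x') (halt : alternation x = alternation x') :
    firstSign x = firstSign x' := by
  obtain ⟨q, hq⟩ := exists_isFirst hx.1
  obtain ⟨q', hq'⟩ := exists_isFirst hx'.1
  rw [hx.firstSign_eq hq, hx'.firstSign_eq hq']
  by_contra hne
  obtain ⟨y, hyx, hy, hc⟩ := exists_card_eq_alternation x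
  have hy0 : y.Nonempty := Finset.card_pos.1 (hc ▸ alternation_pos hx.1)
  obtain ⟨r, hr⟩ := exists_isFirst hy0
  have key : ∀ z (v : Finset (ℕ × ZMod p)), IsSignVector n v → IsFirst v z → y ⊆ v →
      alternation v = alternation x → z.2 = r.2 := by
    intro z v hv hz hyv hval
    by_contra hzr
    have hlt : ∀ w ∈ y, z.1 < w.1 := by
      refine fun w hw => lt_of_lt_of_le (lt_of_le_of_ne (hz.2 r (hyv hr.1)) ?_) (hr.2 w hw)
      intro h
      exact hzr (by rw [hv.2.2 z hz.1 r (hyv hr.1) h])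
    have hins := hy.insert hlt fun w hw hmin => by
      rwa [hv.2.2 w (hyv hw) r (hyv hr.1) (le_antisymm (hmin r hr.1) (hr.2 w hw))]
    have hle := card_le_alternation (Finset.insert_subset hz.1 hyv) hins
    rw [Finset.card_insert_of_notMem fun h => lt_irrefl _ (hlt z h)] at hle
    omega
  exact hne ((key q x hx hq hyx rfl).trans (key q' x' hx' hq' (hyx.trans hsub) halt.symm).symm)

lemma IsSignVector.exists_almostStable [NeZero p] {k : ℕ} (hk : 1 ≤ k)
    {x : Finset (ℕ × ZMod p)} (hx : IsSignVector n x) (halt : p * (k - 1) < alternation x) :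
    ∃ S ∈ almostStableSubsets n k 2, ∃ j, ∀ i ∈ S, (i, j) ∈ x := by
  obtain ⟨y, hyx, hy, hc⟩ := exists_card_eq_alternation x
  obtain ⟨j, -, hj⟩ := Finset.exists_lt_card_fiber_of_mul_lt_card_of_maps_to
    (s := y) (t := (Finset.univ : Finset (ZMod p))) (f := Prod.snd) (n := k - 1)
    (fun _ _ => Finset.mem_univ _) (by rwa [Finset.card_univ, ZMod.card, hc])
  have hkj : k ≤ (y.filter fun q => q.2 = j).card := by omega
  obtain ⟨z, hz, hzc⟩ := Finset.exists_subset_card_eq hkj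
  have hzy : ∀ i ∈ z.image Prod.fst, (i, j) ∈ y ∧ (i, j) ∈ z := by
    intro i hi
    obtain ⟨⟨i, j'⟩, hq, rfl⟩ := Finset.mem_image.1 hi
    obtain ⟨h1, rfl⟩ := Finset.mem_filter.1 (hz hq)
    exact ⟨h1, hq⟩
  refine ⟨z.image Prod.fst, ⟨⟨?_, ?_⟩, ?_⟩, j, fun i hi => hyx (hzy i hi).1⟩
  · intro i hi
    exact Finset.mem_Icc.2 (hx.2.1 _ (hyx (hzy i hi).1))
  · rw [Finset.card_image_of_injOn, hzc]
    intro q hq r hr h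
    exact hx.2.2 q (hyx (Finset.mem_filter.1 (hz hq)).1) r
      (hyx (Finset.mem_filter.1 (hz hr)).1) h
  -- Positions `i` and `i + 1` would be consecutive in the support of `y` and carry the same sign.
  · have hgap : ∀ i ∈ z.image Prod.fst, i + 1 ∉ z.image Prod.fst := by
      intro i hi hi'
      refine hy _ (hzy i hi).1 _ (hzy _ hi').1 (Nat.lt_succ_self i) (fun w _ => ?_) rfl
      simp only
      omega
    intro i hi i' hi' hne
    have h1 := hgap i hi
    have h2 := hgap i' hi'
    have h3 : i + 1 ≠ i' := fun h => h1 (h ▸ hi')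
    have h4 : i' + 1 ≠ i := fun h => h2 (h ▸ hi)
    rw [le_abs]
    omega

end SignVectors

/-! ### Equivariant averages of proper subsets of `ZMod p` -/

section Average

variable {p t : ℕ}

open Classical in
/-- The average of the first nonempty row of a family of subsets of `ZMod p`. -/
noncomputable def firstRowAverage (B : Fin t → Finset (ZMod p)) : ZMod p :=
  if h : ∃ m, (B m).Nonempty ∧ ∀ c < m, B c = ∅ then
    (∑ j ∈ B h.choose, j) * ((B h.choose).card : ZMod p)⁻¹ else 0

lemma firstRowAverage_eq {B : Fin t → Finset (ZMod p)} {m : Fin t} (hm : (B m).Nonempty)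
    (hlt : ∀ c < m, B c = ∅) :
    firstRowAverage B = (∑ j ∈ B m, j) * ((B m).card : ZMod p)⁻¹ := by
  have h : ∃ m, (B m).Nonempty ∧ ∀ c < m, B c = ∅ := ⟨m, hm, hlt⟩
  obtain ⟨h1, h2⟩ := h.choose_spec
  have hmm : h.choose = m := by
    rcases lt_trichotomy h.choose m with hl | hl | hl
    · exact absurd (hlt _ hl) h1.ne_empty
    · exact hl
    · exact absurd (h2 _ hl) hm.ne_empty
  rw [firstRowAverage, dif_pos h, hmm]

/-- The cardinality of a nonempty proper subset is invertible modulo the prime `p`, so translating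
by `1` moves the average by exactly `1`. -/
lemma firstRowAverage_add_one [Fact p.Prime] {B B' : Fin t → Finset (ZMod p)}
    (hB' : ∀ c, B' c = (B c).image (· + 1)) (hne : ∃ c, (B c).Nonempty)
    (hproper : ∀ c, (B c).card < p) : firstRowAverage B' = firstRowAverage B + 1 := by
  classical
  obtain ⟨m, hm, hmin⟩ := Finset.exists_min_image
    (Finset.univ.filter fun c => (B c).Nonempty) id (by simpa [Finset.filter_nonempty_iff] using hne)
  have hm : (B m).Nonempty := by simpa using hm
  have hlt : ∀ c < m, B c = ∅ := by
    intro c hc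
    by_contra h
    exact absurd (hmin c (by simpa [Finset.nonempty_iff_ne_empty] using h)) (not_le.2 hc)
  have hcard : ((B m).card : ZMod p) ≠ 0 := by
    rw [Ne, ZMod.natCast_eq_zero_iff]
    exact Nat.not_dvd_of_pos_of_lt hm.card_pos (hproper m)
  rw [firstRowAverage_eq hm hlt, firstRowAverage_eq (m := m) (by rw [hB']; exact hm.image _)
    (fun c hc => by rw [hB', hlt c hc, Finset.image_empty]), hB',
    Finset.card_image_of_injective _ (add_left_injective 1),
    Finset.sum_image (fun _ _ _ _ h => add_left_injective 1 h), Finset.sum_add_distrib]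
  simp only [Finset.sum_const, nsmul_eq_mul, mul_one]
  field_simp

end Average

/-! ### Bounds for the chromatic numbers -/

/-- The values `j` such that some vertex of color `d` is contained in the level set of `j`
in `x`. -/
noncomputable def colorPattern {p t : ℕ} [NeZero p] {F : Set (Finset ℕ)} (c : F → Fin t)
    (x : Finset (ℕ × ZMod p)) (d : Fin t) : Finset (ZMod p) :=
  open Classical in {j | ∃ S : F, c S = d ∧ ∀ i ∈ S.1, (i, j) ∈ x}

/-! ### Lower bound: color patterns of sign vectors -/

section Lower

variable {p n k t : ℕ} [Fact p.Prime]

lemma mem_colorPattern {F : Set (Finset ℕ)} {c : F → Fin t} {x : Finset (ℕ × ZMod p)}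
    {d : Fin t} {j : ZMod p} :
    j ∈ colorPattern c x d ↔ ∃ S : F, c S = d ∧ ∀ i ∈ S.1, (i, j) ∈ x := by
  simp [colorPattern]

lemma colorPattern_rotateVector {F : Set (Finset ℕ)} (c : F → Fin t) (x : Finset (ℕ × ZMod p))
    (d : Fin t) : colorPattern c (rotateVector x) d = (colorPattern c x d).image (· + 1) := by
  ext j
  obtain ⟨j, rfl⟩ : ∃ j', j' + 1 = j := ⟨j - 1, by ring⟩
  rw [(add_left_injective (1 : ZMod p)).mem_finset_image]
  simp only [mem_colorPattern, mk_add_one_mem_rotateVector]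

lemma colorPattern_mono {F : Set (Finset ℕ)} (c : F → Fin t) {x x' : Finset (ℕ × ZMod p)}
    (h : x ⊆ x') (d : Fin t) : colorPattern c x d ⊆ colorPattern c x' d := by
  intro j hj
  obtain ⟨S, hS, hi⟩ := mem_colorPattern.1 hj
  exact mem_colorPattern.2 ⟨S, hS, fun i h' => h (hi i h')⟩

/-- If all `p` signs occurred, vertices of color `d` in the `p` disjoint level sets would form a
monochromatic edge. -/
lemma card_colorPattern_lt {F : Set (Finset ℕ)} (hF : ∀ S ∈ F, S.Nonempty) {c : F → Fin t}
    (hc : ∀ e ∈ (disjointness p F).edgeSet, ∃ x y : F, (x : Finset ℕ) ∈ e ∧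
      (y : Finset ℕ) ∈ e ∧ c x ≠ c y)
    {x : Finset (ℕ × ZMod p)} (hx : IsSignVector n x) (d : Fin t) :
    (colorPattern c x d).card < p := by
  by_contra hge
  have huniv : colorPattern c x d = Finset.univ := by
    rw [← Finset.card_eq_iff_eq_univ, ZMod.card]
    exact le_antisymm ((Finset.card_le_univ _).trans_eq (ZMod.card p)) (not_lt.1 hge)
  have hall : ∀ j, ∃ S : F, c S = d ∧ ∀ i ∈ S.1, (i, j) ∈ x := fun j =>
    mem_colorPattern.1 (huniv ▸ Finset.mem_univ j)
  choose S hSc hSx using hall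
  have hdisj : ∀ j j', j ≠ j' → Disjoint (S j).1 (S j').1 := by
    intro j j' hne
    rw [Finset.disjoint_left]
    intro i hi hi'
    have := hx.2.2 _ (hSx j i hi) _ (hSx j' i hi') rfl
    simp_all
  have hinj : Function.Injective fun j => (S j).1 := by
    intro j j' h
    by_contra hne
    have := hdisj j j' hne
    simp only at h
    rw [h, disjoint_self] at this
    exact (hF _ (S j').2).ne_empty this
  have hedge : (Set.range fun j => (S j).1) ∈ (disjointness p F).edgeSet := by
    refine ⟨?_, ?_, ?_⟩
    · rintro _ ⟨j, rfl⟩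
      exact (S j).2
    · rw [← Set.image_univ, hinj.encard_image, Set.encard_univ, ENat.card_eq_coe_fintype_card,
        ZMod.card]
    · rintro _ ⟨j, rfl⟩ _ ⟨j', rfl⟩ hne
      exact hdisj j j' fun h => hne (by rw [h])
  obtain ⟨u, v, ⟨j, hj⟩, ⟨j', hj'⟩, huv⟩ := hc _ hedge
  rw [← Subtype.ext hj, ← Subtype.ext hj', hSc, hSc] at huv
  exact huv rfl

/-- Lower bound for the number of colors of the almost `2`-stable Kneser hypergraph. -/
theorem le_of_properlyColorable_almostStableKneser (hk : 1 ≤ k)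
    (h : (almostStableKneser p n k 2).ProperlyColorable t) :
    n ≤ p * (k - 1) + t * (p - 1) := by
  obtain ⟨c, hc⟩ := h
  change almostStableSubsets n k 2 → Fin t at c
  by_contra hn
  obtain ⟨i, rfl⟩ : ∃ i, n = i + 1 := ⟨n - 1, by omega⟩
  have hF : ∀ S ∈ almostStableSubsets (i + 1) k 2, S.Nonempty := fun S hS =>
    Finset.card_pos.1 (by rw [hS.1.2]; omega)
  let w : Finset (ℕ × ZMod p) → ℕ := fun x => ∑ d, (colorPattern c x d).card
  have hlt := fun {x} (hx : IsSignVector (i + 1) x) (d : Fin t) =>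
    card_colorPattern_lt (p := p) hF hc hx d
  have hw : ∀ x : Finset (ℕ × ZMod p), IsSignVector (i + 1) x → w x ≤ t * (p - 1) := by
    intro x hx
    have := Finset.sum_le_card_nsmul Finset.univ _ (p - 1) fun d _ =>
      Nat.le_sub_one_of_lt (hlt hx d)
    simpa using this
  have hne : ∀ x : Finset (ℕ × ZMod p), IsSignVector (i + 1) x → p * (k - 1) < alternation x →
      ∃ d, (colorPattern c x d).Nonempty := by
    intro x hx hax
    obtain ⟨S, hS, j, hj⟩ := hx.exists_almostStable hk hax
    exact ⟨c ⟨S, hS⟩, j, mem_colorPattern.2 ⟨⟨S, hS⟩, rfl, hj⟩⟩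
  have hwpos : ∀ x : Finset (ℕ × ZMod p), IsSignVector (i + 1) x → p * (k - 1) < alternation x →
      0 < w x := by
    intro x hx hax
    obtain ⟨d, hd⟩ := hne x hx hax
    exact Finset.sum_pos' (fun _ _ => Nat.zero_le _) ⟨d, Finset.mem_univ d, hd.card_pos⟩
  have hwrot : ∀ x, w (rotateVector x) = w x := fun x => Finset.sum_congr rfl fun d _ => by
    rw [colorPattern_rotateVector, Finset.card_image_of_injective _ (add_left_injective 1)]
  -- The shifts by `-1` start the levels at `0`; positivity of `w` places the second range above the
  -- first.
  refine not_exists_equivariant (p := p) rotateVector_iterate_self isContractingTower_isSignVector i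
    (fun x => if alternation x ≤ p * (k - 1) then (alternation x - 1, firstSign x)
      else (p * (k - 1) + w x - 1, firstRowAverage (colorPattern c x))) ?_ ?_ ?_
  · intro x hx
    simp only [alternation_rotateVector]
    split_ifs with hax
    · rw [hx.firstSign_rotateVector, rotate]
    · rw [hwrot, firstRowAverage_add_one (colorPattern_rotateVector c x)
        (hne x hx (not_le.1 hax)) (hlt hx), rotate]
  · intro x y hx hy hxy
    have hxy : x ⊆ y := hxy
    have hmono := alternation_mono hxy
    have hposx := alternation_pos hx.1
    by_cases hay : alternation y ≤ p * (k - 1)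
    · simp only [hay, hmono.trans hay, if_true]
      rcases hmono.eq_or_lt with heq | hl
      · left
        rw [heq, hx.firstSign_eq_of_subset hy hxy heq]
      · right
        omega
    · have hwy := hwpos y hy (not_le.1 hay)
      by_cases hax : alternation x ≤ p * (k - 1)
      · simp only [hay, hax, if_true, if_false]
        right
        omega
      · simp only [hay, hax, if_false]
        have hwx := hwpos x hx (not_le.1 hax)
        have hwle : ∀ d ∈ Finset.univ, (colorPattern c x d).card ≤ (colorPattern c y d).card :=
          fun d _ => Finset.card_le_card (colorPattern_mono c hxy d)
        rcases (Finset.sum_le_sum hwle).eq_or_lt with heq | hl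
        · left
          -- Nested patterns of equal total size agree color by color, hence have the same average.
          have : colorPattern c x = colorPattern c y := by
            funext d
            refine Finset.eq_of_subset_of_card_le (colorPattern_mono c hxy d) ?_
            exact ((Finset.sum_eq_sum_iff_of_le hwle).1 heq d (Finset.mem_univ d)).ge
          simp only [w, this]
        · right
          change w x < w y at hl
          omega
  · intro x hx
    have hposx := alternation_pos hx.1
    have hwx := hw x hx
    split_ifs with hax
    · simp only
      omega
    · have := hwpos x hx (not_le.1 hax)
      simp only
      omega

end Lower

/-- The greedy coloring of the Kneser hypergraph. -/
theorem properlyColorable_kneser {p n k t : ℕ} (hp : 2 ≤ p) (hk : 1 ≤ k) (ht : 1 ≤ t)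
    (h : n ≤ p * (k - 1) + t * (p - 1)) : (kneser p n k).ProperlyColorable t := by
  have hne : ∀ S : kSubsets n k, S.1.Nonempty := fun S =>
    Finset.card_pos.1 (by rw [S.2.2]; omega)
  let m : kSubsets n k → ℕ := fun S => (S.1.min' (hne S) - 1) / (p - 1)
  refine ⟨fun S => ⟨min (m S) (t - 1), by omega⟩, ?_⟩
  rintro e ⟨heF, hecard, hedisj⟩
  by_contra! hmonochrom
  have hefin : e.Finite := Set.finite_of_encard_eq_coe hecard
  lift e to Finset (Finset ℕ) using hefin
  rw [Set.encard_coe_eq_coe_finsetCard, Nat.cast_inj] at hecard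
  have hval : ∀ S T : kSubsets n k, S.1 ∈ e → T.1 ∈ e → min (m S) (t - 1) = min (m T) (t - 1) :=
    fun S T hS hT => congrArg Fin.val (hmonochrom S T hS hT)
  have hbound : ∀ S ∈ e, ∀ i ∈ S, 1 ≤ i ∧ i ≤ n := fun S hS i hi =>
    Finset.mem_Icc.1 ((heF hS).1 hi)
  obtain ⟨S₀, hS₀⟩ : e.Nonempty := Finset.card_pos.1 (by omega)
  have hpw : (e : Set (Finset ℕ)).PairwiseDisjoint id := hedisj
  -- An edge in the last color would need `p * k` points, but at most `p * k - 1` remain from `(t -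
  -- 1) * (p - 1) + 1` on. In any other color its `p` distinct minima would share a block of length
  -- `p - 1`.
  by_cases hlast : t - 1 ≤ m ⟨S₀, heF hS₀⟩
  · have hsub : e.biUnion id ⊆ Finset.Icc ((t - 1) * (p - 1) + 1) n := by
      intro i hi
      obtain ⟨S, hS, hiS⟩ := Finset.mem_biUnion.1 hi
      have hb := hbound S hS i hiS
      have h1 := hval ⟨S, heF hS⟩ ⟨S₀, heF hS₀⟩ hS hS₀
      have h2 : t - 1 ≤ m ⟨S, heF hS⟩ := by omega
      have h3 := (Nat.le_div_iff_mul_le (by omega)).1 h2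
      have h4 : S.min' (hne ⟨S, heF hS⟩) ≤ i := Finset.min'_le _ _ hiS
      rw [Finset.mem_Icc]
      simp only at h3
      omega
    have hc := Finset.card_le_card hsub
    have hsum : ∑ S ∈ e, (id S).card = p * k := by
      exact hecard ▸ Finset.sum_const_nat fun S hS => (heF hS).2
    rw [Finset.card_biUnion hpw, Nat.card_Icc, hsum] at hc
    obtain ⟨t, rfl⟩ : ∃ t', t = t' + 1 := ⟨t - 1, by omega⟩
    obtain ⟨k, rfl⟩ : ∃ k', k = k' + 1 := ⟨k - 1, by omega⟩
    simp only [Nat.add_sub_cancel, Nat.mul_add, Nat.add_mul] at *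
    omega
  · have hmin : ∀ S (hS : S ∈ e), m ⟨S, heF hS⟩ = m ⟨S₀, heF hS₀⟩ := by
      intro S hS
      have := hval ⟨S, heF hS⟩ ⟨S₀, heF hS₀⟩ hS hS₀
      omega
    set r := m ⟨S₀, heF hS₀⟩
    let g : Finset ℕ → ℕ := fun S => if h : S.Nonempty then S.min' h else 0
    have hg : ∀ S ∈ e, g S ∈ S := by
      intro S hS
      simp only [g, dif_pos (hne ⟨S, heF hS⟩)]
      exact Finset.min'_mem _ _
    have hcard := Finset.card_le_card_of_injOn (s := e)
      (t := Finset.Icc (r * (p - 1) + 1) (r * (p - 1) + (p - 1))) g ?_ ?_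
    · rw [hecard, Nat.card_Icc] at hcard
      omega
    · intro S hS
      have h1 := hmin S hS
      have h2 := hbound S hS _ (hg S hS)
      have h3 : (g S - 1) / (p - 1) = r := by
        rw [← h1]
        simp only [g, m, dif_pos (hne ⟨S, heF hS⟩)]
      rw [Nat.div_eq_iff (by omega)] at h3
      rw [Finset.mem_coe, Finset.mem_Icc]
      rw [mul_comm]
      rw [mul_comm] at h3
      omega
    · intro S hS T hT hST
      by_contra hne'
      exact Finset.disjoint_left.1 (hedisj hS hT hne') (hg S hS) (hST ▸ hg T hT)

/-! ### Comparison of the two hypergraphs and the numerical bound -/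

lemma ProperlyColorable.of_subset {r t : ℕ} {F G : Set (Finset ℕ)} (hFG : F ⊆ G)
    (h : (disjointness r G).ProperlyColorable t) : (disjointness r F).ProperlyColorable t := by
  obtain ⟨c, hc⟩ := h
  refine ⟨fun S => c ⟨S.1, hFG S.2⟩, ?_⟩
  rintro e ⟨he, he'⟩
  obtain ⟨x, y, hx, hy, hxy⟩ := hc e ⟨he.trans hFG, he'⟩
  exact ⟨⟨x, he hx⟩, ⟨y, he hy⟩, hx, hy, hxy⟩

lemma chromaticNumber_eq {α : Type*} {H : Hypergraph α} {m : ℕ} (h : H.ProperlyColorable m)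
    (hle : ∀ t, H.ProperlyColorable t → m ≤ t) : H.chromaticNumber = m :=
  le_antisymm (iInf₂_le m h) (le_iInf₂ fun t ht => Nat.cast_le.2 (hle t ht))

lemma ceil_le_iff_le_add {p n k t : ℕ} (hp : 2 ≤ p) (hk : 1 ≤ k) :
    ⌈((n : ℚ) - ((k : ℚ) - 1) * (p : ℚ)) / ((p : ℚ) - 1)⌉₊ ≤ t ↔
      n ≤ p * (k - 1) + t * (p - 1) := by
  have hp' : (2 : ℚ) ≤ p := by exact_mod_cast hp
  rw [Nat.ceil_le, div_le_iff₀ (by linarith), ← Nat.cast_le (α := ℚ)]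
  push_cast [Nat.cast_sub hk, Nat.cast_sub (show 1 ≤ p by omega)]
  constructor <;> intro h <;> linarith

end Hypergraph

theorem theorem1 (p n k : ℕ) (hp : p.Prime) (hk : 1 ≤ k) (hn : p * k ≤ n) :
    ((⌈((n : ℚ) - ((k : ℚ) - 1) * (p : ℚ)) / ((p : ℚ) - 1)⌉₊ : ℕ) : ℕ∞) ≤
        (Hypergraph.almostStableKneser p n k 2).chromaticNumber ∧
      (Hypergraph.almostStableKneser p n k 2).chromaticNumber =
        ((⌈((n : ℚ) - ((k : ℚ) - 1) * (p : ℚ)) / ((p : ℚ) - 1)⌉₊ : ℕ) : ℕ∞) ∧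
      (Hypergraph.kneser p n k).chromaticNumber =
        ((⌈((n : ℚ) - ((k : ℚ) - 1) * (p : ℚ)) / ((p : ℚ) - 1)⌉₊ : ℕ) : ℕ∞) := by
  have := Fact.mk hp
  set m := ⌈((n : ℚ) - ((k : ℚ) - 1) * (p : ℚ)) / ((p : ℚ) - 1)⌉₊ with hm
  have hiff : ∀ t, m ≤ t ↔ n ≤ p * (k - 1) + t * (p - 1) := fun t =>
    Hypergraph.ceil_le_iff_le_add hp.two_le hk
  -- The greedy coloring needs at least one color; `n ≥ p * k > p * (k - 1)` supplies it.
  have hm1 : 1 ≤ m := by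
    by_contra h
    have h0 := (hiff 0).1 (by omega)
    have := Nat.mul_lt_mul_of_pos_left (Nat.sub_lt hk one_pos) hp.pos
    omega
  have hcol := Hypergraph.properlyColorable_kneser hp.two_le hk hm1 ((hiff m).1 le_rfl)
  have hsub : Hypergraph.almostStableSubsets n k 2 ⊆ Hypergraph.kSubsets n k := fun _ h => h.1
  have hlow : ∀ t, (Hypergraph.almostStableKneser p n k 2).ProperlyColorable t → m ≤ t :=
    fun t ht => (hiff t).2 (Hypergraph.le_of_properlyColorable_almostStableKneser hk ht)
  have hstable := Hypergraph.chromaticNumber_eq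
    (Hypergraph.ProperlyColorable.of_subset hsub hcol) hlow
  refine ⟨hstable.ge, hstable, Hypergraph.chromaticNumber_eq hcol fun t ht => ?_⟩
  exact hlow t (Hypergraph.ProperlyColorable.of_subset hsub ht)
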